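/- Let $M$ be a matroid on a finite ground set $E$, with rank function $\mathrm{rk}_M$ and $\mathrm{rk}\,M=\mathrm{rk}_M(E)$ (realizability is not assumed, and loops are allowed). For $w\in\mathbb Z^E$ put $$|w|=\sum_{e\in E}w_e,\qquad \mathrm{wt}_M(w)=\max_{B\text{ basis of }M}\ \sum_{e\in B}w_e,$$ and let $M_w$ be the matroid on $E$ whose bases are the bases $B$ of $M$ with $\sum_{e\in B}w_e=\mathrm{wt}_M(w)$. Write $\mathbf 1\in\mathbb Z^E$ for the all-ones vector. For $v\in\mathbb Z^E/\mathbb Z\mathbf 1$ and any lift $w\in\mathbb Z^E$ of $v$ put $$M_v=M_w,\qquad \overline{\mathrm{wt}}_M(v)=\mathrm{wt}_M(w)-(\mathrm{rk}\,M)\min(w),\qquad \overline{|v|}=|w|-(\#E)\min(w),$$ where $\min(w)$ is the least coordinate of $w$ (and $0$ if $E=\varnothing$); these do not depend on the lift. The reduced characteristic polynomial of a matroid $N$ on $E$ is $$\overline\chi_N(q)=\sum_{S\subseteq E}(-1)^{\#S}\left(1+q+\cdots+q^{\mathrm{rk}\,N-\mathrm{rk}_N(S)-1}\right)\in\mathbb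 Z[q],$$ where the bracket is $0$ if $\mathrm{rk}_N(S)=\mathrm{rk}\,N$ (so that for $E\neq\varnothing$, $(q-1)\,\overline\chi_N(q)=\sum_{S\subseteq E}(-1)^{\#S}q^{\mathrm{rk}\,N-\mathrm{rk}_N(S)}$ is the characteristic polynomial of $N$). The reduced motivic zeta function of $M$ is the power series $$\overline Z_M(q,T)=\sum_{v\in\mathbb Z^E/\mathbb Z\mathbf 1}\overline\chi_{M_v}(q)\,q^{-(\mathrm{rk}\,M-1)-\overline{\mathrm{wt}}_M(v)}\,T^{\overline{|v|}}\in\mathbb Z[q^{\pm1}][[T]].$$ Theorem. The series $\overline Z_M(q,T)$ is the expansion at $T=0$ of a (necessarily unique) rational function in $\mathbb Q(q)(T)$, and this rational function, again denoted $\overline Z_M(q,T)$, satisfies $$\overline Z_M(q^{-1},T^{-1})=q^{\mathrm{rk}\,M-1}\,\overline Z_M(q,T)\qquad\text{in }\mathbb Q(q)(T).$$ -/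

import Mathlib

open scoped LaurentPolynomial PowerSeries LaurentSeries

noncomputable section

namespace Matroid

section Exchange

/-- Symmetric basis exchange. -/
theorem IsBase.symmetric_exchange {E : Type*} {M : Matroid E} {B B' : Set E}
    (hB : M.IsBase B) (hB' : M.IsBase B') {e : E} (he : e ∈ B \ B') :
    ∃ f ∈ B' \ B, M.IsBase (insert f (B \ {e})) ∧ M.IsBase (insert e (B' \ {f})) := by
  have heE : e ∈ M.E := hB.subset_ground he.1
  have hC : M.IsCircuit (M.fundCircuit e B') := hB'.fundCircuit_isCircuit heE he.2
  have hK := hB.compl_closure_sdiff_singleton_isCocircuit he.1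
  have heC : e ∈ M.fundCircuit e B' := M.mem_fundCircuit e B'
  have heK : e ∈ M.E \ M.closure (B \ {e}) :=
    ⟨heE, hB.indep.notMem_closure_sdiff_of_mem he.1⟩
  obtain ⟨f, hf, hfe⟩ := (hC.isCocircuit_inter_nontrivial hK ⟨e, heC, heK⟩).exists_ne e
  have hfB' : f ∈ B' := by
    have := M.fundCircuit_subset_insert e B' hf.1
    exact this.resolve_left hfe
  have hfB : f ∉ B := fun h =>
    hf.2.2 (M.mem_closure_of_mem' ⟨h, hfe⟩ (hB.subset_ground h))
  refine ⟨f, ⟨hfB', hfB⟩, hB.exchange_base_of_notMem_closure he.1 hf.2.2 hf.2.1, ?_⟩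
  have hcl : e ∈ M.closure B' := by rw [hB'.closure_eq]; exact heE
  have hind := (hB'.indep.mem_fundCircuit_iff hcl he.2).1 hf.1
  have hef : e ∉ B' \ {f} := fun h => he.2 h.1
  have hcomm := Set.insert_sdiff_singleton_comm (s := B') (Ne.symm hfe)
  rw [hcomm]
  exact hB'.exchange_isBase_of_indep' hfB' he.2 hind

end Exchange

section Weights

variable {E : Type*} [Fintype E]
set_option linter.unusedSectionVars false

open Classical in
/-- The total weight `∑_{e ∈ B} w_e` of a set `B`. -/
def setWeight (w : E → ℤ) (B : Set E) : ℤ := ∑ e with e ∈ B, w e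

open Classical in
/-- The finite set of bases of `M`. -/
def bases (M : Matroid E) : Finset (Set E) := Finset.univ.filter M.IsBase

theorem mem_bases {M : Matroid E} {B : Set E} : B ∈ M.bases ↔ M.IsBase B := by
  simp [bases]

theorem bases_nonempty (M : Matroid E) : M.bases.Nonempty := by
  obtain ⟨B, hB⟩ := M.exists_isBase
  exact ⟨B, mem_bases.2 hB⟩

/-- `wt_M(w)`: the maximum of `∑_{e ∈ B} w_e` over the bases `B` of `M`. -/
def wt (M : Matroid E) (w : E → ℤ) : ℤ := M.bases.sup' M.bases_nonempty (setWeight w)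

theorem IsBase.setWeight_le_wt {M : Matroid E} {B : Set E} (hB : M.IsBase B) (w : E → ℤ) :
    setWeight w B ≤ M.wt w :=
  Finset.le_sup' (setWeight w) (mem_bases.2 hB)

theorem exists_isBase_setWeight_eq_wt (M : Matroid E) (w : E → ℤ) :
    ∃ B, M.IsBase B ∧ setWeight w B = M.wt w := by
  obtain ⟨B, hB, h⟩ := Finset.exists_mem_eq_sup' M.bases_nonempty (setWeight w)
  exact ⟨B, mem_bases.1 hB, h.symm⟩

theorem setWeight_exchange (w : E → ℤ) {B : Set E} {e f : E} (he : e ∈ B) (hf : f ∉ B) :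
    setWeight w (insert f (B \ {e})) = setWeight w B - w e + w f := by
  classical
  have h0 (C : Set E) : setWeight w C = ∑ x, C.indicator w x := by
    simp [setWeight, Finset.sum_filter, Set.indicator_apply]
  have h1 (x : E) : (insert f (B \ {e})).indicator w x =
      B.indicator w x - (if x = e then w x else 0) + (if x = f then w x else 0) := by
    by_cases hxf : x = f
    · subst hxf
      have : x ≠ e := fun h => hf (h ▸ he)
      simp [hf, this]
    · by_cases hxe : x = e
      · subst hxe; simp [he, hxf]
      · simp [Set.indicator_apply, hxf, hxe]
  simp only [h0, h1, Finset.sum_add_distrib, Finset.sum_sub_distrib]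
  simp

/-- `M_w`: the matroid on the ground set of `M` whose bases are the bases `B` of `M` of maximal
weight, i.e. with `∑_{e ∈ B} w_e = wt_M(w)`. -/
def initialMatroid (M : Matroid E) (w : E → ℤ) : Matroid E :=
  Matroid.ofIsBaseOfFinite (Set.toFinite M.E)
    (fun B => M.IsBase B ∧ setWeight w B = M.wt w)
    (M.exists_isBase_setWeight_eq_wt w)
    (by
      rintro B B' ⟨hB, hw⟩ ⟨hB', hw'⟩ e he
      obtain ⟨f, hf, h1, h2⟩ := hB.symmetric_exchange hB' he
      refine ⟨f, hf, h1, ?_⟩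
      have e1 := setWeight_exchange w he.1 hf.2
      have e2 := setWeight_exchange w hf.1 he.2
      have l1 := h1.setWeight_le_wt w
      have l2 := h2.setWeight_le_wt w
      linarith)
    (fun B hB => hB.1.subset_ground)

@[simp] theorem initialMatroid_isBase {M : Matroid E} {w : E → ℤ} {B : Set E} :
    (M.initialMatroid w).IsBase B ↔ M.IsBase B ∧ setWeight w B = M.wt w := Iff.rfl

@[simp] theorem initialMatroid_ground (M : Matroid E) (w : E → ℤ) :
    (M.initialMatroid w).E = M.E := rfl

/-- The rank `rk_M(S)` as a natural number. -/
def rkNat (M : Matroid E) (S : Set E) : ℕ := (M.eRk S).toNat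

/-- The rank `rk M = rk_M(E)` of a matroid. -/
def rankNat (M : Matroid E) : ℕ := M.rkNat M.E

theorem IsBase.ncard_eq_rankNat {M : Matroid E} {B : Set E} (hB : M.IsBase B) :
    B.ncard = M.rankNat := by
  simp [rankNat, rkNat, eRk_ground, ← hB.encard_eq_eRank, Set.ncard_def]

/-- `min(w)`, the least coordinate of `w` (with the value `0` if there are no coordinates). -/
def minCoord (w : E → ℤ) : ℤ := ⨅ e, w e

/-- `|w| = ∑_e w_e`. -/
def totalWeight (w : E → ℤ) : ℤ := ∑ e, w e

theorem setWeight_add_const (w : E → ℤ) (c : ℤ) (B : Set E) :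
    setWeight (fun e => w e + c) B = setWeight w B + B.ncard * c := by
  classical
  simp [setWeight, Finset.sum_add_distrib, Set.ncard_eq_toFinset_card', Set.toFinset]

theorem wt_add_const (M : Matroid E) (w : E → ℤ) (c : ℤ) :
    M.wt (fun e => w e + c) = M.wt w + M.rankNat * c := by
  apply le_antisymm
  · obtain ⟨B, hB, h⟩ := M.exists_isBase_setWeight_eq_wt (fun e => w e + c)
    rw [← h, setWeight_add_const, hB.ncard_eq_rankNat]
    have := hB.setWeight_le_wt w
    linarith
  · obtain ⟨B, hB, h⟩ := M.exists_isBase_setWeight_eq_wt w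
    have := hB.setWeight_le_wt (fun e => w e + c)
    rw [setWeight_add_const, hB.ncard_eq_rankNat] at this
    linarith

theorem initialMatroid_add_const (M : Matroid E) (w : E → ℤ) (c : ℤ) :
    M.initialMatroid (fun e => w e + c) = M.initialMatroid w := by
  refine Matroid.ext_isBase rfl ?_
  intro B _
  simp only [initialMatroid_isBase, wt_add_const]
  refine and_congr_right fun hB => ?_
  rw [setWeight_add_const, hB.ncard_eq_rankNat]
  constructor <;> intro h <;> linarith

theorem minCoord_add_const [Nonempty E] (w : E → ℤ) (c : ℤ) :
    minCoord (fun e => w e + c) = minCoord w + c := by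
  unfold minCoord
  exact (ciInf_add (Set.finite_range w).bddBelow c).symm

theorem totalWeight_add_const (w : E → ℤ) (c : ℤ) :
    totalWeight (fun e => w e + c) = totalWeight w + Fintype.card E * c := by
  simp [totalWeight, Finset.sum_add_distrib]

variable (E) in
/-- The quotient group `ℤ^E / ℤ𝟏`. -/
abbrev ModOnes : Type _ := (E → ℤ) ⧸ AddSubgroup.zmultiples (1 : E → ℤ)

/-- Descend a function that is invariant under adding constants to `ℤ^E / ℤ𝟏`. -/
def ModOnes.lift {β : Type*} (f : (E → ℤ) → β)
    (hf : ∀ w c, f (fun e => w e + c) = f w) : ModOnes E → β :=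
  fun v => Quotient.liftOn' v f (by
    intro a b hab
    rw [QuotientAddGroup.leftRel_apply] at hab
    obtain ⟨c, hc⟩ := hab
    have : b = fun e => a e + c := by
      funext e
      have := congrFun hc e
      simp at this
      linarith
    rw [this, hf])

@[simp] theorem ModOnes.lift_mk {β : Type*} (f : (E → ℤ) → β)
    (hf : ∀ w c, f (fun e => w e + c) = f w) (w : E → ℤ) :
    ModOnes.lift f hf (QuotientAddGroup.mk w) = f w := rfl

/-- `M_v := M_w` for `v ∈ ℤ^E / ℤ𝟏` and any lift `w` of `v`. -/
def initialMatroidBar (M : Matroid E) : ModOnes E → Matroid E :=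
  ModOnes.lift M.initialMatroid M.initialMatroid_add_const

/-- `wt_M(w) - (rk M) min(w)` for any lift `w` of `v`. -/
def wtBar (M : Matroid E) : ModOnes E → ℤ :=
  ModOnes.lift (fun w => M.wt w - M.rankNat * minCoord w) (by
    intro w c
    rcases isEmpty_or_nonempty E with h | h
    · rw [Subsingleton.elim (fun e => w e + c) w]
    · simp only [wt_add_const, minCoord_add_const]; ring)

/-- `|w| - (#E) min(w)` for any lift `w` of `v`. -/
def totalWeightBar : ModOnes E → ℤ :=
  ModOnes.lift (fun w => totalWeight w - Fintype.card E * minCoord w) (by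
    intro w c
    rcases isEmpty_or_nonempty E with h | h
    · rw [Subsingleton.elim (fun e => w e + c) w]
    · simp only [totalWeight_add_const, minCoord_add_const]; ring)

theorem minCoord_le (w : E → ℤ) (e : E) : minCoord w ≤ w e :=
  ciInf_le (Set.finite_range w).bddBelow e

theorem totalWeightBar_mk (w : E → ℤ) :
    totalWeightBar (QuotientAddGroup.mk w) = ∑ e, (w e - minCoord w) := by
  simp [totalWeightBar, totalWeight]

theorem totalWeightBar_nonneg (v : ModOnes E) : 0 ≤ totalWeightBar v := by
  induction v using QuotientAddGroup.induction_on with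
  | H w =>
    rw [totalWeightBar_mk]
    exact Finset.sum_nonneg fun e _ => sub_nonneg.2 (minCoord_le w e)

/-- Only finitely many classes `v` have a given value of `totalWeightBar`. -/
theorem finite_totalWeightBar_eq (n : ℕ) :
    {v : ModOnes E | totalWeightBar v = (n : ℤ)}.Finite := by
  classical
  refine ((Set.finite_Icc (fun _ : E => (0 : ℤ)) (fun _ => (n : ℤ))).image
    (QuotientAddGroup.mk (s := AddSubgroup.zmultiples (1 : E → ℤ)))).subset ?_
  intro v hv
  induction v using QuotientAddGroup.induction_on with
  | H w =>
    simp only [Set.mem_ofPred_eq, totalWeightBar_mk] at hv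
    have h0 : ∀ e, 0 ≤ w e - minCoord w := fun e => sub_nonneg.2 (minCoord_le w e)
    refine ⟨fun e => w e - minCoord w, ⟨fun e => h0 e, fun e => ?_⟩, ?_⟩
    · show w e - minCoord w ≤ n
      rw [← hv]
      exact Finset.single_le_sum (f := fun e => w e - minCoord w) (fun e _ => h0 e)
        (Finset.mem_univ e)
    · rw [QuotientAddGroup.eq]
      refine ⟨minCoord w, ?_⟩
      funext e
      simp

end Weights

section Zeta

variable {E : Type*} [Fintype E]

open Polynomial in
/-- The characteristic polynomial `χ_M(q) = ∑_{S ⊆ E} (-1)^{#S} q^{rk M - rk S}`. -/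
def charPoly (M : Matroid E) : ℤ[X] :=
  ∑ S : Finset E, (-1) ^ S.card * X ^ (M.rankNat - M.rkNat S)

open Polynomial in
/-- The reduced characteristic polynomial `∑_{S ⊆ E} (-1)^{#S} [rk M - rk S]_q`, where
`[n]_q = 1 + q + ⋯ + q^{n-1}`. -/
def reducedCharPoly (M : Matroid E) : ℤ[X] :=
  ∑ S : Finset E, (-1) ^ S.card * ∑ i ∈ Finset.range (M.rankNat - M.rkNat S), X ^ i

open Polynomial in
/-- For a nonempty ground set, the reduced characteristic polynomial is `χ_M(q) / (q - 1)`. -/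
theorem reducedCharPoly_mul [Nonempty E] (M : Matroid E) :
    M.reducedCharPoly * (X - 1) = M.charPoly := by
  have h : ∑ S : Finset E, (-1 : ℤ[X]) ^ S.card = 0 := by
    have := Finset.sum_powerset_neg_one_pow_card_of_nonempty (x := (Finset.univ : Finset E))
      Finset.univ_nonempty
    rw [Finset.powerset_univ] at this
    simpa using congrArg (Int.castRingHom ℤ[X]) this
  have h2 (S : Finset E) : ((-1 : ℤ[X]) ^ S.card *
      ∑ i ∈ Finset.range (M.rankNat - M.rkNat S), X ^ i) * (X - 1) =
      (-1) ^ S.card * X ^ (M.rankNat - M.rkNat S) - (-1) ^ S.card := by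
    rw [mul_assoc, geom_sum_mul, mul_sub, mul_one]
  rw [reducedCharPoly, charPoly, Finset.sum_mul, Finset.sum_congr rfl fun S _ => h2 S,
    Finset.sum_sub_distrib, h, sub_zero]

/-- The reduced motivic zeta function
`∑_{v ∈ ℤ^E/ℤ𝟏} χ̄_{M_v}(q) q^{-(rk M - 1) - wtBar_M(v)} T^{totalWeightBar v}`,
a power series in `T` with coefficients in `ℤ[q, q⁻¹]`. The generator `LaurentPolynomial.T 1` of
the coefficient ring plays the role of `q`, and the power series variable that of `T`. -/
def reducedZeta (M : Matroid E) : ℤ[T;T⁻¹]⟦X⟧ :=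
  PowerSeries.mk fun n =>
    ∑ v ∈ (finite_totalWeightBar_eq (E := E) n).toFinset,
      Polynomial.toLaurent (M.initialMatroidBar v).reducedCharPoly *
        LaurentPolynomial.T (-((M.rankNat : ℤ) - 1) - M.wtBar v)

end Zeta

end Matroid

namespace RationalFunctions

/-- The field `ℚ(q)`. -/
abbrev Qq : Type := RatFunc ℚ

/-- The field `ℚ(q)(T)`. -/
abbrev QqT : Type := RatFunc Qq

/-- The inclusion `ℤ[q, q⁻¹] → ℚ(q)`. -/
def laurentToQq : ℤ[T;T⁻¹] →+* Qq :=
  LaurentPolynomial.eval₂ (Int.castRingHom Qq) (Units.mk0 RatFunc.X RatFunc.X_ne_zero)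

open scoped RatFunc in
/-- The inclusion `ℚ(q)(T) → ℚ(q)((T))`, expansion at `T = 0`. -/
def expand : QqT →+* Qq⸨X⸩ := algebraMap (RatFunc Qq) (Qq⸨X⸩)

@[simp] theorem expand_X : expand RatFunc.X = HahnSeries.single 1 1 := RatFunc.coe_X

/-- The inclusion `ℤ[q, q⁻¹]⟦T⟧ → ℚ(q)((T))`. -/
def toLaurentSeries (f : ℤ[T;T⁻¹]⟦X⟧) : Qq⸨X⸩ :=
  ((PowerSeries.map laurentToQq f : Qq⟦X⟧) : Qq⸨X⸩)

theorem eval₂_inv_ne_zero {K : Type*} [Field K] (σ : K →+* K) {p : Polynomial K} (hp : p ≠ 0) :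
    p.eval₂ (RatFunc.C.comp σ) (RatFunc.X : RatFunc K)⁻¹ ≠ 0 := by
  intro h
  have hr : (p.map σ).reverse ≠ 0 := by
    rw [Ne, Polynomial.reverse_eq_zero]
    exact (Polynomial.map_ne_zero_iff σ.injective).2 hp
  rw [← Polynomial.eval₂_map] at h
  let _ : Invertible (RatFunc.X : RatFunc K)⁻¹ :=
    invertibleOfNonzero (inv_ne_zero RatFunc.X_ne_zero)
  rw [← Polynomial.eval₂_reverse_eq_zero_iff, invOf_eq_inv, inv_inv] at h
  refine hr (RatFunc.algebraMap_injective K ?_)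
  rw [map_zero, ← h, Polynomial.eval₂_eq_sum_range]
  conv_lhs => rw [Polynomial.as_sum_range_C_mul_X_pow (p.map σ).reverse]
  simp

theorem nonZeroDivisors_le_comap_inv {K : Type*} [Field K] (σ : K →+* K) :
    nonZeroDivisors (Polynomial K) ≤ (nonZeroDivisors (RatFunc K)).comap
      (Polynomial.eval₂RingHom (RatFunc.C.comp σ) (RatFunc.X : RatFunc K)⁻¹) := fun _ hp =>
  mem_nonZeroDivisors_of_ne_zero (eval₂_inv_ne_zero σ (nonZeroDivisors.ne_zero hp))

/-- For a field endomorphism `σ` of `K`, the field endomorphism `f(X) ↦ f^σ(X⁻¹)` of `K(X)`,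
where `f^σ` is `f` with `σ` applied to the coefficients. -/
def invMap {K : Type*} [Field K] (σ : K →+* K) : RatFunc K →+* RatFunc K :=
  RatFunc.liftRingHom (Polynomial.eval₂RingHom (RatFunc.C.comp σ) (RatFunc.X)⁻¹)
    (nonZeroDivisors_le_comap_inv σ)

theorem invMap_algebraMap {K : Type*} [Field K] (σ : K →+* K) (p : Polynomial K) :
    invMap σ (algebraMap (Polynomial K) (RatFunc K) p) =
      p.eval₂ (RatFunc.C.comp σ) (RatFunc.X)⁻¹ :=
  RatFunc.liftRingHom_algebraMap _ (nonZeroDivisors_le_comap_inv σ) p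

@[simp] theorem invMap_X {K : Type*} [Field K] (σ : K →+* K) :
    invMap σ RatFunc.X = (RatFunc.X)⁻¹ := by
  conv_lhs => rw [← RatFunc.algebraMap_X, invMap_algebraMap, Polynomial.eval₂_X]

@[simp] theorem invMap_C {K : Type*} [Field K] (σ : K →+* K) (a : K) :
    invMap σ (RatFunc.C a) = RatFunc.C (σ a) := by
  rw [← RatFunc.algebraMap_C, invMap_algebraMap, Polynomial.eval₂_C]
  rfl

/-- The substitution `f(q) ↦ f(q⁻¹)` on `ℚ(q)`. -/
def invertQ : Qq →+* Qq := invMap (RingHom.id ℚ)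

/-- The substitution `f(q, T) ↦ f(q⁻¹, T⁻¹)` on `ℚ(q)(T)`. -/
def invertQT : QqT →+* QqT := invMap invertQ

end RationalFunctions

end

noncomputable section

namespace Matroid

/-! Classes in `ℤ^E / ℤ𝟏` are represented by vectors `w ∈ ℕ^E` with a zero coordinate, that is, with
support `A ≠ E`. Write `w = w' + 1_A` with `w' ∈ ℕ^A`. Raising `w'` by one on `A` adds `rk A` to the
maximal weight, and the characteristic polynomial of the initial matroid factors as that of `(M |
A)_{w'}` times that of the contraction by `A` (`latticeTerm_add_indicator`). Let `κ(A, B)` be the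
characteristic polynomial of `(M | B) / A`, `x_A = q^{-rk A} T^{#A}`, and `Z_B` the series of all `w
∈ ℕ^B`. Summing over supports gives `Z_B = ∑_{A ⊆ B} κ(A, B) x_A Z_A`. So `f_A = x_A Z_A` satisfies
a recursion solvable by division by `1 - x_B`, which proves rationality; the reduced zeta function
is `q^{-(rk M - 1)} / (q - 1)` times `∑_{A ⊂ E} κ(A, E) f_A`.

For the functional equation, `q ↦ q⁻¹` turns `κ` into its inverse in the incidence algebra,
conjugated by `q^{rk}` (`rankKernel_inv`). By induction on `B`, the substitution `(q, T) ↦ (q⁻¹,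
T⁻¹)` sends `f_B` to `q^{-rk B} Z_B` (`map_chainSum`). Since `κ⁻¹` applied to `Z = κ f` returns `f`,
the sum of `κ(A, B) f_A` over proper subsets `A` is then multiplied by `-q^{-rk B}`
(`map_sum_ssubsets_chainSum`); the sign is absorbed by the factor `1 / (q - 1)`. -/

@[simp] theorem rkNat_empty {E : Type*} (M : Matroid E) : M.rkNat ∅ = 0 := by
  simp [rkNat]

/-! ### Maximal weights and ranks in initial matroids -/

section WeightCalculus

variable {E : Type*} [Fintype E] {M : Matroid E}

theorem setWeight_eq_sum_indicator (w : E → ℤ) (B : Set E) :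
    setWeight w B = ∑ e, B.indicator w e := by
  classical
  simp [setWeight, Finset.sum_filter, Set.indicator_apply]

theorem setWeight_add (w w' : E → ℤ) (B : Set E) :
    setWeight (w + w') B = setWeight w B + setWeight w' B := by
  simp [setWeight, Finset.sum_add_distrib]

theorem setWeight_indicator_one (S B : Set E) :
    setWeight (S.indicator 1) B = ((B ∩ S).ncard : ℤ) := by
  classical
  rw [setWeight_eq_sum_indicator, Set.indicator_indicator, Set.ncard_eq_toFinset_card',
    Set.toFinset_card, Fintype.card_subtype]
  simp [Set.indicator_apply]

theorem setWeight_mono {w : E → ℤ} (hw : ∀ e, 0 ≤ w e) {B B' : Set E} (h : B ⊆ B') :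
    setWeight w B ≤ setWeight w B' := by
  simp only [setWeight_eq_sum_indicator]
  exact Finset.sum_le_sum fun e _ => Set.indicator_le_indicator_of_subset h hw e

theorem setWeight_inter_of_support_subset {w : E → ℤ} {A : Set E} (hA : ∀ e ∉ A, w e = 0)
    (B : Set E) : setWeight w (B ∩ A) = setWeight w B := by
  classical
  simp only [setWeight_eq_sum_indicator]
  refine Finset.sum_congr rfl fun e _ => ?_
  by_cases he : e ∈ A
  · simp [Set.indicator_apply, he]
  · simp [Set.indicator_apply, he, hA e he]

theorem natCast_rkNat (M : Matroid E) (S : Set E) : (M.rkNat S : ℕ∞) = M.eRk S :=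
  ENat.natCast_toNat (eRk_ne_top_iff.2 (M.isRkFinite_of_finite S.toFinite))

theorem Indep.ncard_le_rkNat {I S : Set E} (hI : M.Indep I) (hIS : I ⊆ S) :
    I.ncard ≤ M.rkNat S := by
  have h := M.eRk_mono hIS
  rw [hI.eRk_eq_encard, ← natCast_rkNat, ← Set.Finite.cast_ncard_eq I.toFinite] at h
  exact_mod_cast h

theorem IsBase.ncard_inter_le_rkNat {B : Set E} (hB : M.IsBase B) (S : Set E) :
    (B ∩ S).ncard ≤ M.rkNat S :=
  (hB.indep.inter_right S).ncard_le_rkNat Set.inter_subset_right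

theorem Indep.exists_isBase_ncard_inter_eq_rkNat {I S : Set E} (hI : M.Indep I) (hIS : I ⊆ S)
    (hS : S ⊆ M.E) : ∃ B, M.IsBase B ∧ I ⊆ B ∧ (B ∩ S).ncard = M.rkNat S := by
  obtain ⟨J, hJ, hIJ⟩ := hI.subset_isBasis_of_subset hIS hS
  obtain ⟨B, hB, hJB⟩ := hJ.indep.exists_isBase_superset
  refine ⟨B, hB, hIJ.trans hJB, (hB.ncard_inter_le_rkNat S).antisymm ?_⟩
  have h : M.rkNat S = J.ncard := by
    have := hJ.encard_eq_eRk
    rw [← natCast_rkNat, ← Set.Finite.cast_ncard_eq J.toFinite] at this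
    exact_mod_cast this.symm
  rw [h]
  exact Set.ncard_le_ncard (Set.subset_inter hJB hJ.subset)

theorem rkNat_mono (M : Matroid E) {S S' : Set E} (h : S ⊆ S') : M.rkNat S ≤ M.rkNat S' := by
  have := M.eRk_mono h
  rw [← natCast_rkNat, ← natCast_rkNat] at this
  exact_mod_cast this

/-- Raising a nonnegative weight supported in `A` by one on `A` raises its maximum by `rk A`. -/
theorem wt_add_indicator_one {w : E → ℤ} {A : Set E} (hw : ∀ e, 0 ≤ w e)
    (hA : ∀ e ∉ A, w e = 0) (hAE : A ⊆ M.E) :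
    M.wt (w + A.indicator 1) = M.wt w + M.rkNat A := by
  apply le_antisymm
  · obtain ⟨B, hB, h⟩ := M.exists_isBase_setWeight_eq_wt (w + A.indicator 1)
    rw [← h, setWeight_add, setWeight_indicator_one]
    have h1 := hB.setWeight_le_wt w
    have h2 := hB.ncard_inter_le_rkNat A
    lia
  -- Starting from an optimal base, keep its part in `A` and complete it to a base meeting `A` in
  -- rank `A` elements. No weight is lost, as `w` is nonnegative and vanishes off `A`.
  · obtain ⟨B₀, hB₀, h₀⟩ := M.exists_isBase_setWeight_eq_wt w
    obtain ⟨B, hB, hsub, hcard⟩ :=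
      (hB₀.indep.inter_right A).exists_isBase_ncard_inter_eq_rkNat Set.inter_subset_right hAE
    have h := hB.setWeight_le_wt (w + A.indicator 1)
    rw [setWeight_add, setWeight_indicator_one, hcard] at h
    have h1 := setWeight_mono hw hsub
    rw [setWeight_inter_of_support_subset hA, h₀] at h1
    linarith

/-- A base of maximal weight for `2 w + 1_S` has maximal weight for `w`. -/
theorem IsBase.setWeight_eq_wt_of_perturbation {w : E → ℤ} {S B : Set E} (hB : M.IsBase B)
    (h : setWeight (w + w + S.indicator 1) B = M.wt (w + w + S.indicator 1)) :
    setWeight w B = M.wt w := by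
  -- Choose a `w`-optimal base closest to `B`; an exchange would produce a closer one.
  obtain ⟨B', hB', hmin⟩ := (Set.toFinite {B' | M.IsBase B' ∧ setWeight w B' = M.wt w}
    ).exists_minimalFor (fun B' => (B \ B').ncard) _ (M.exists_isBase_setWeight_eq_wt w)
  obtain ⟨hB', hw'⟩ := hB'
  rcases (B \ B').eq_empty_or_nonempty with h0 | ⟨e, he⟩
  · rwa [hB.eq_of_subset_isBase hB' (Set.sdiff_eq_empty.1 h0)]
  obtain ⟨f, hf, h1, h2⟩ := hB.symmetric_exchange hB' he
  have l1 := h1.setWeight_le_wt (w + w + S.indicator 1)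
  have l2 := h2.setWeight_le_wt w
  have e1 := setWeight_exchange (w + w + S.indicator 1) he.1 hf.2
  have e2 := setWeight_exchange w hf.1 he.2
  have hi (x : E) : S.indicator (1 : E → ℤ) x = 0 ∨ S.indicator (1 : E → ℤ) x = 1 := by
    by_cases hx : x ∈ S <;> simp [hx]
  simp only [Pi.add_apply] at e1
  have hmem : M.IsBase (insert e (B' \ {f})) ∧ setWeight w (insert e (B' \ {f})) = M.wt w := by
    refine ⟨h2, ?_⟩
    -- Optimality of `B'` gives `w e ≤ w f`, and that of `B` gives `2 (w f - w e) ≤ 1`. The factor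
    -- `2` and integrality force `w e = w f`.
    rcases hi e with h3 | h3 <;> rcases hi f with h4 | h4 <;> rw [h3, h4] at e1 <;> lia
  have hlt : (B \ insert e (B' \ {f})).ncard < (B \ B').ncard := by
    refine Set.ncard_lt_ncard ⟨?_, fun hs => (hs he).2 (Set.mem_insert e _)⟩
    rintro x ⟨hx, hx'⟩
    refine ⟨hx, fun hxB' => hx' (Or.inr ⟨hxB', ?_⟩)⟩
    rintro rfl
    exact hf.2 hx
  exact absurd (hmin hmem hlt.le) (not_le.2 hlt)

/-- The bases optimal for `2 w + 1_S` are the `w`-optimal ones that meet `S` most. Ranks in `M_w`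
thus become differences of maximal weights in `M` itself. -/
theorem rkNat_initialMatroid (w : E → ℤ) {S : Set E} (hS : S ⊆ M.E) :
    ((M.initialMatroid w).rkNat S : ℤ) = M.wt (w + w + S.indicator 1) - 2 * M.wt w := by
  apply le_antisymm
  · obtain ⟨B, hB, -, hcard⟩ := (M.initialMatroid w).empty_indep.exists_isBase_ncard_inter_eq_rkNat
      (Set.empty_subset S) hS
    rw [initialMatroid_isBase] at hB
    have h := hB.1.setWeight_le_wt (w + w + S.indicator 1)
    rw [setWeight_add, setWeight_add, setWeight_indicator_one, hcard, hB.2] at h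
    linarith
  · obtain ⟨B, hB, h⟩ := M.exists_isBase_setWeight_eq_wt (w + w + S.indicator 1)
    have hBw := hB.setWeight_eq_wt_of_perturbation h
    have hle := IsBase.ncard_inter_le_rkNat (M := M.initialMatroid w)
      (initialMatroid_isBase.2 ⟨hB, hBw⟩) S
    rw [← h, setWeight_add, setWeight_add, setWeight_indicator_one, hBw]
    lia

theorem rankNat_initialMatroid (M : Matroid E) (w : E → ℤ) :
    (M.initialMatroid w).rankNat = M.rankNat := by
  obtain ⟨B, hB⟩ := (M.initialMatroid w).exists_isBase
  rw [← hB.ncard_eq_rankNat, ← (initialMatroid_isBase.1 hB).1.ncard_eq_rankNat]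

end WeightCalculus

end Matroid

/-! ### The rank kernel, its inverse and reciprocity for the chain recursion -/

section RankKernel

open Finset

variable {E K : Type*} [DecidableEq E] [Field K]

theorem Finset.sum_Icc_neg_one_pow_card {R : Type*} [CommRing R] (A B : Finset E) :
    ∑ S ∈ Icc A B, (-1 : R) ^ #S = if A = B then (-1) ^ #B else 0 := by
  by_cases hAB : A ⊆ B
  · rw [Icc_eq_image_powerset hAB, sum_image]
    · have h (S : Finset E) (hS : S ∈ (B \ A).powerset) :
          (-1 : R) ^ #(A ∪ S) = (-1) ^ #A * (-1) ^ #S := by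
        rw [card_union_of_disjoint, pow_add]
        exact disjoint_of_subset_right (mem_powerset.1 hS) disjoint_sdiff
      have h2 := congrArg (Int.castRingHom R) (sum_powerset_neg_one_pow_card (x := B \ A))
      rw [sum_congr rfl h, ← mul_sum]
      simp only [map_sum, map_pow, map_neg, map_one] at h2
      rw [h2]
      by_cases h : A = B
      · simp [h]
      · have : B \ A ≠ ∅ := fun h0 => h (hAB.antisymm (sdiff_eq_empty_iff_subset.1 h0))
        simp [h, this]
    · intro S hS S' hS' h
      simp only [coe_powerset, Set.mem_preimage, Set.mem_powerset_iff, coe_subset,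
        subset_sdiff] at hS hS'
      rw [← union_sdiff_cancel_left hS.2.symm, ← union_sdiff_cancel_left hS'.2.symm]
      exact congrArg (· \ A) h
  · rw [Icc_eq_empty hAB, sum_empty, if_neg]
    rintro rfl
    exact hAB subset_rfl

/-- Binomial inversion: the operator `V f (B) = ∑_{S ⊆ B} (-1)^{#S} f S` is an involution. -/
theorem Finset.sum_powerset_neg_one_pow_card_mul_sum {R : Type*} [CommRing R]
    (f : Finset E → R) (B : Finset E) :
    ∑ S ∈ B.powerset, (-1) ^ #S * ∑ A ∈ S.powerset, (-1) ^ #A * f A = f B := by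
  simp_rw [mul_sum]
  rw [sum_comm' (t' := B.powerset) (s' := fun A => Icc A B)]
  · have h (A : Finset E) : ∑ S ∈ Icc A B, (-1 : R) ^ #S * ((-1) ^ #A * f A) =
        if A = B then f A else 0 := by
      rw [← sum_mul, sum_Icc_neg_one_pow_card]
      split_ifs with hA
      · rw [hA, ← mul_assoc, ← pow_add, Even.neg_one_pow ⟨_, rfl⟩, one_mul]
      · rw [zero_mul]
    simp [h]
  · simp only [mem_powerset, mem_Icc]
    exact fun A S => ⟨fun h => ⟨⟨h.2, h.1⟩, h.2.trans h.1⟩, fun h => ⟨h.1.2, h.1.1⟩⟩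

/-- `∑_{A ⊆ S ⊆ B} (-1)^{#S - #A} q^{ρ B - ρ S}`. When `ρ` is the rank function of a matroid, this
is the characteristic polynomial of the minor `(M | B) / A`. -/
def rankKernel (q : K) (ρ : Finset E → ℤ) (A B : Finset E) : K :=
  ∑ S ∈ Icc A B, (-1) ^ (#S + #A) * q ^ (ρ B - ρ S)

/-- `∑_{A ⊆ S ⊆ B} (-1)^{#S - #A} q^{ρ S - ρ A}`, the inverse of `rankKernel` in the incidence
algebra. -/
def rankKernelInv (q : K) (ρ : Finset E → ℤ) (A B : Finset E) : K :=
  ∑ S ∈ Icc A B, (-1) ^ (#S + #A) * q ^ (ρ S - ρ A)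

@[simp] theorem rankKernel_self (q : K) (ρ : Finset E → ℤ) (A : Finset E) :
    rankKernel q ρ A A = 1 := by
  simp [rankKernel, ← two_mul]

@[simp] theorem rankKernelInv_self (q : K) (ρ : Finset E → ℤ) (A : Finset E) :
    rankKernelInv q ρ A A = 1 := by
  simp [rankKernelInv, ← two_mul]

theorem rankKernel_inv {q : K} (hq : q ≠ 0) (ρ : Finset E → ℤ) (A B : Finset E) :
    rankKernel q⁻¹ ρ A B = q ^ (-ρ B) * rankKernelInv q ρ A B * q ^ ρ A := by
  simp only [rankKernel, rankKernelInv, mul_sum, sum_mul]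
  refine sum_congr rfl fun S _ => ?_
  rw [inv_zpow', mul_left_comm, mul_assoc, mul_assoc, ← zpow_add₀ hq, ← zpow_add₀ hq]
  ring_nf

variable {L : Type*} [Field L]

theorem map_rankKernel (φ : K →+* L) (q : K) (ρ : Finset E → ℤ) (A B : Finset E) :
    φ (rankKernel q ρ A B) = rankKernel (φ q) ρ A B := by
  simp [rankKernel]

/-- With `D` the multiplication by `q^ρ`, the kernel acts as `D V D⁻¹ V`, where `V` is the signed
subset sum. -/
theorem sum_rankKernel_mul {q : K} (hq : q ≠ 0) (ρ : Finset E → ℤ) (g : Finset E → K)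
    (B : Finset E) : ∑ A ∈ B.powerset, rankKernel q ρ A B * g A =
      q ^ ρ B * ∑ S ∈ B.powerset, (-1) ^ #S * (q ^ (-ρ S) *
        ∑ A ∈ S.powerset, (-1) ^ #A * g A) := by
  simp only [rankKernel, sum_mul, mul_sum]
  rw [sum_comm' (t' := B.powerset) (s' := fun S => S.powerset)]
  · refine sum_congr rfl fun S _ => sum_congr rfl fun A _ => ?_
    rw [sub_eq_add_neg, zpow_add₀ hq, pow_add]
    ring
  · simp only [mem_powerset, mem_Icc]
    exact fun A S => ⟨fun h => ⟨h.2.1, h.2.2⟩, fun h => ⟨h.1.trans h.2, h⟩⟩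

theorem sum_rankKernelInv_mul {q : K} (hq : q ≠ 0) (ρ : Finset E → ℤ) (g : Finset E → K)
    (B : Finset E) : ∑ A ∈ B.powerset, rankKernelInv q ρ A B * g A =
      ∑ S ∈ B.powerset, (-1) ^ #S * (q ^ ρ S *
        ∑ A ∈ S.powerset, (-1) ^ #A * (q ^ (-ρ A) * g A)) := by
  simp only [rankKernelInv, sum_mul, mul_sum]
  rw [sum_comm' (t' := B.powerset) (s' := fun S => S.powerset)]
  · refine sum_congr rfl fun S _ => sum_congr rfl fun A _ => ?_
    rw [sub_eq_add_neg, zpow_add₀ hq, pow_add]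
    ring
  · simp only [mem_powerset, mem_Icc]
    exact fun A S => ⟨fun h => ⟨h.2.1, h.2.2⟩, fun h => ⟨h.1.trans h.2, h⟩⟩

/-- The two kernels act as `D V D⁻¹ V` and `V D V D⁻¹`, which are mutually inverse because `V` is an
involution. -/
theorem sum_rankKernelInv_mul_of_sum_rankKernel_mul {q : K} (hq : q ≠ 0) (ρ : Finset E → ℤ)
    {f g : Finset E → K} (h : ∀ B, g B = ∑ A ∈ B.powerset, rankKernel q ρ A B * f A)
    (B : Finset E) : ∑ A ∈ B.powerset, rankKernelInv q ρ A B * g A = f B := by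
  have h1 (A : Finset E) : q ^ (-ρ A) * g A = ∑ S ∈ A.powerset, (-1) ^ #S * (q ^ (-ρ S) *
      ∑ A ∈ S.powerset, (-1) ^ #A * f A) := by
    rw [h, sum_rankKernel_mul hq ρ, ← mul_assoc, ← zpow_add₀ hq, neg_add_cancel, zpow_zero,
      one_mul]
  rw [sum_rankKernelInv_mul hq]
  simp_rw [h1, sum_powerset_neg_one_pow_card_mul_sum]
  simp_rw [← mul_assoc (q ^ ρ _), ← zpow_add₀ hq, add_neg_cancel, zpow_zero, one_mul]
  exact sum_powerset_neg_one_pow_card_mul_sum f B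

/-- The solution of `f B = x_B / (1 - x_B) * ∑_{A ⊂ B} κ(A, B) f A` with `f ∅ = 1`, where `κ` is the
rank kernel. -/
def chainSum (q : K) (ρ : Finset E → ℤ) (x : Finset E → K) : Finset E → K :=
  Finset.strongInduction fun B ih =>
    if B = ∅ then 1
    else x B / (1 - x B) * ∑ A ∈ B.ssubsets.attach,
      rankKernel q ρ A B * ih A (mem_ssubsets.1 A.2)

theorem chainSum_empty (q : K) (ρ : Finset E → ℤ) (x : Finset E → K) :
    chainSum q ρ x ∅ = 1 := by
  rw [chainSum, Finset.strongInduction_eq, if_pos rfl]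

theorem chainSum_of_nonempty (q : K) (ρ : Finset E → ℤ) (x : Finset E → K) {B : Finset E}
    (hB : B ≠ ∅) : chainSum q ρ x B =
      x B / (1 - x B) * ∑ A ∈ B.ssubsets, rankKernel q ρ A B * chainSum q ρ x A := by
  rw [chainSum, Finset.strongInduction_eq, if_neg hB,
    ← sum_attach _ fun A => rankKernel q ρ A B * _]

theorem sum_powerset_eq_add_sum_ssubsets {R : Type*} [AddCommMonoid R] (f : Finset E → R)
    (B : Finset E) : ∑ A ∈ B.powerset, f A = f B + ∑ A ∈ B.ssubsets, f A := by
  rw [ssubsets, add_sum_erase _ _ (mem_powerset_self B)]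

variable {q : K} {ρ : Finset E → ℤ} {x : Finset E → K}

/-- With `f` the chain sum and `g = κ f`, the inverse relation `κ⁻¹ g = f` has diagonal term `g B`,
so its part over proper subsets is `f B - g B`, the negative of the proper part of `κ f`. -/
theorem map_sum_ssubsets_chainSum (hq : q ≠ 0) {φ : K →+* K} (hφq : φ q = q⁻¹) {B : Finset E}
    (h : ∀ A ⊂ B, φ (chainSum q ρ x A) =
      q ^ (-ρ A) * ∑ C ∈ A.powerset, rankKernel q ρ C A * chainSum q ρ x C) :
    φ (∑ A ∈ B.ssubsets, rankKernel q ρ A B * chainSum q ρ x A) =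
      -q ^ (-ρ B) * ∑ A ∈ B.ssubsets, rankKernel q ρ A B * chainSum q ρ x A := by
  have hinv := sum_rankKernelInv_mul_of_sum_rankKernel_mul hq ρ
    (f := chainSum q ρ x) (fun _ => rfl) B
  rw [sum_powerset_eq_add_sum_ssubsets, rankKernelInv_self, one_mul,
    sum_powerset_eq_add_sum_ssubsets, rankKernel_self, one_mul] at hinv
  have h1 : φ (∑ A ∈ B.ssubsets, rankKernel q ρ A B * chainSum q ρ x A) =
      q ^ (-ρ B) * ∑ A ∈ B.ssubsets, rankKernelInv q ρ A B *
        ∑ C ∈ A.powerset, rankKernel q ρ C A * chainSum q ρ x C := by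
    rw [map_sum, mul_sum]
    refine sum_congr rfl fun A hA => ?_
    rw [map_mul, map_rankKernel, hφq, h A (mem_ssubsets.1 hA), rankKernel_inv hq, mul_assoc,
      ← mul_assoc (q ^ ρ A), ← zpow_add₀ hq, add_neg_cancel, zpow_zero, one_mul, mul_assoc]
  rw [h1]
  linear_combination q ^ (-ρ B) * hinv

/-- With `s` the proper part of `κ f` at `B`, both sides equal `q^{-ρ B} s / (1 - x_B)`: the sign
from inverting `x_B / (1 - x_B)` cancels the sign in the transformation of `s`. -/
theorem map_chainSum (hq : q ≠ 0) (hρ : ρ ∅ = 0) (hx0 : ∀ B, x B ≠ 0)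
    (hx1 : ∀ B, B ≠ ∅ → x B ≠ 1) {φ : K →+* K} (hφq : φ q = q⁻¹)
    (hφx : ∀ B, φ (x B) = (x B)⁻¹) (B : Finset E) : φ (chainSum q ρ x B) =
      q ^ (-ρ B) * ∑ C ∈ B.powerset, rankKernel q ρ C B * chainSum q ρ x C := by
  induction B using Finset.strongInduction with
  | H B ih =>
    rcases eq_or_ne B ∅ with rfl | hB
    · simp [chainSum_empty, hρ]
    have h := map_sum_ssubsets_chainSum hq hφq ih
    rw [sum_powerset_eq_add_sum_ssubsets, rankKernel_self, one_mul]
    rw [chainSum_of_nonempty q ρ x hB, map_mul, h, map_div₀, map_sub, map_one, hφx]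
    have h0 := hx0 B
    have h1 : 1 - x B ≠ 0 := sub_ne_zero.2 (hx1 B hB).symm
    have h2 : x B - 1 ≠ 0 := sub_ne_zero.2 (hx1 B hB)
    have h3 : (x B)⁻¹ / (1 - (x B)⁻¹) = -(1 / (1 - x B)) := by
      have : 1 - (x B)⁻¹ ≠ 0 := by
        rw [sub_ne_zero, ne_comm, inv_ne_one]
        exact hx1 B hB
      field_simp
      ring
    have h4 : x B / (1 - x B) + 1 = 1 / (1 - x B) := by
      field_simp
      ring
    rw [h3]
    linear_combination -(q ^ (-ρ B) *
      ∑ A ∈ B.ssubsets, rankKernel q ρ A B * chainSum q ρ x A) * h4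

/-- The reciprocity law for the sum defining `chainSum`. -/
theorem map_sum_ssubsets_chainSum_eq (hq : q ≠ 0) (hρ : ρ ∅ = 0) (hx0 : ∀ B, x B ≠ 0)
    (hx1 : ∀ B, B ≠ ∅ → x B ≠ 1) {φ : K →+* K} (hφq : φ q = q⁻¹)
    (hφx : ∀ B, φ (x B) = (x B)⁻¹) (B : Finset E) :
    φ (∑ A ∈ B.ssubsets, rankKernel q ρ A B * chainSum q ρ x A) =
      -q ^ (-ρ B) * ∑ A ∈ B.ssubsets, rankKernel q ρ A B * chainSum q ρ x A :=
  map_sum_ssubsets_chainSum hq hφq fun A _ => map_chainSum hq hρ hx0 hx1 hφq hφx A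

/-- `chainSum` is determined by its recursion after any embedding of fields. -/
theorem map_chainSum_eq (hx1 : ∀ B, B ≠ ∅ → x B ≠ 1) (ψ : K →+* L) {f : Finset E → L}
    (h0 : f ∅ = 1) (hf : ∀ B, B ≠ ∅ → f B =
      ψ (x B) * ∑ A ∈ B.powerset, ψ (rankKernel q ρ A B) * f A) (B : Finset E) :
    ψ (chainSum q ρ x B) = f B := by
  induction B using Finset.strongInduction with
  | H B ih =>
    rcases eq_or_ne B ∅ with rfl | hB
    · rw [chainSum_empty, map_one, h0]
    have h1 : 1 - ψ (x B) ≠ 0 := by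
      rw [← map_one ψ, ← map_sub]
      exact (map_ne_zero ψ).2 (sub_ne_zero.2 (hx1 B hB).symm)
    -- The term `A = B` on the right is `ψ (x B) * f B`; moving it to the left produces the
    -- denominator `1 - x B`.
    have h := hf B hB
    rw [sum_powerset_eq_add_sum_ssubsets, rankKernel_self, map_one, one_mul] at h
    rw [chainSum_of_nonempty q ρ x hB, map_mul, map_sum, map_div₀, map_sub, map_one]
    rw [sum_congr rfl fun A hA => (map_mul ψ _ _).trans
      (congrArg (ψ (rankKernel q ρ A B) * ·) (ih A (mem_ssubsets.1 hA))),
      div_mul_eq_mul_div, div_eq_iff h1]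
    linear_combination -h

end RankKernel

namespace Matroid

/-! ### Generating series over lattice points, decomposed by support -/

section LatticeSeries

open Finset

variable {E K : Type*} [Fintype E] [DecidableEq E] [Field K]

/-- The rank function of `M` on finite sets, with values in `ℤ`. -/
def rkInt (M : Matroid E) (S : Finset E) : ℤ := M.rkNat S

theorem wt_natCast_add_indicator {M : Matroid E} (hM : M.E = Set.univ) {A : Finset E} {w : E → ℕ}
    (hw : ∀ e ∉ A, w e = 0) : M.wt (fun e => ((w e + if e ∈ A then 1 else 0 : ℕ) : ℤ)) =
      M.wt (fun e => (w e : ℤ)) + M.rkInt A := by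
  rw [rkInt, ← wt_add_indicator_one (fun e => Int.natCast_nonneg (w e))
    (fun e he => by simp [hw e (by simpa using he)]) (hM ▸ Set.subset_univ _)]
  congr 1
  funext e
  by_cases he : e ∈ A <;> simp [he]

/-- As `w` vanishes off `A`, `2 (w + 1_A) + 1_S = (2 w + 1_{S ∩ A}) + 1_A + 1_{S ∪ A}`. Each of the
last two indicators is added to a weight supported in its set, so `wt_add_indicator_one` applies
twice. -/
theorem wt_perturbation_add_indicator {M : Matroid E} (hM : M.E = Set.univ) {A : Finset E}
    {w : E → ℕ} (hw : ∀ e ∉ A, w e = 0) (S : Finset E) :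
    M.wt ((fun e => ((w e + if e ∈ A then 1 else 0 : ℕ) : ℤ)) +
      (fun e => ((w e + if e ∈ A then 1 else 0 : ℕ) : ℤ)) + (S : Set E).indicator 1) =
      M.wt ((fun e => (w e : ℤ)) + (fun e => (w e : ℤ)) +
        ((S ∩ A : Finset E) : Set E).indicator 1) + M.rkInt A + M.rkInt (S ∪ A) := by
  have hE (X : Set E) : X ⊆ M.E := hM ▸ Set.subset_univ X
  have hi (X : Set E) (e : E) : 0 ≤ X.indicator (1 : E → ℤ) e :=
    Set.indicator_nonneg (fun _ _ => zero_le_one) e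
  have h0 (e : E) : 0 ≤ (((fun e => (w e : ℤ)) + (fun e => (w e : ℤ)) +
      ((S ∩ A : Finset E) : Set E).indicator 1 : E → ℤ)) e :=
    add_nonneg (add_nonneg (Int.natCast_nonneg _) (Int.natCast_nonneg _)) (hi _ e)
  rw [rkInt, rkInt, ← wt_add_indicator_one h0 _ (hE _), ← wt_add_indicator_one _ _ (hE _)]
  · congr 1
    funext e
    by_cases he : e ∈ A <;> by_cases he' : e ∈ S <;> simp [he, he', hw] <;> ring
  · exact fun e => add_nonneg (h0 e) (hi _ e)
  · intro e he
    simp only [coe_union, Set.mem_union, mem_coe, not_or] at he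
    simp [he, hw]
  · intro e he
    rw [mem_coe] at he
    simp [he, hw]

/-- The contribution `χ_{(M | B)_w}(q) q^{-wt(w)}` of a lattice point `w` supported in `B`. -/
def latticeTerm (M : Matroid E) (q : K) (B : Finset E) (w : E → ℕ) : K :=
  ∑ S ∈ B.powerset, (-1) ^ #S * q ^ (M.rkInt B + M.wt (fun e => (w e : ℤ)) -
    M.wt ((fun e => (w e : ℤ)) + (fun e => (w e : ℤ)) + (S : Set E).indicator 1))

/-- The subsets `S` of `B` correspond to pairs `(S ∪ A, S ∩ A)`. The exponent splits accordingly,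
the first entry giving the rank kernel and the second the term for `A`. -/
theorem latticeTerm_add_indicator {M : Matroid E} (hM : M.E = Set.univ) {q : K} (hq : q ≠ 0)
    {A B : Finset E} (hAB : A ⊆ B) {w : E → ℕ} (hw : ∀ e ∉ A, w e = 0) :
    M.latticeTerm q B (fun e => w e + if e ∈ A then 1 else 0) =
      rankKernel q M.rkInt A B * (q ^ (-M.rkInt A) * M.latticeTerm q A w) := by
  simp only [latticeTerm, wt_natCast_add_indicator hM hw, wt_perturbation_add_indicator hM hw]
  rw [rankKernel, mul_sum, sum_mul_sum, ← sum_product']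
  refine sum_nbij' (fun S => (S ∪ A, S ∩ A)) (fun p => p.2 ∪ (p.1 \ A)) ?_ ?_ ?_ ?_ ?_
  · intro S hS
    simp only [mem_product, mem_Icc, mem_powerset] at hS ⊢
    exact ⟨⟨subset_union_right, union_subset hS hAB⟩, inter_subset_right⟩
  · rintro ⟨S, S'⟩ h
    simp only [mem_product, mem_Icc, mem_powerset] at h ⊢
    exact union_subset (h.2.trans hAB) (sdiff_subset.trans h.1.2)
  · intro S _
    ext e
    by_cases he : e ∈ A <;> simp [he]
  · rintro ⟨S, S'⟩ h
    simp only [mem_product, mem_Icc, mem_powerset] at h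
    ext e
    · by_cases he : e ∈ A
      · simpa [he] using h.1.1 he
      · simpa [he] using fun h' => absurd (h.2 h') he
    · by_cases he : e ∈ A
      · simp [he]
      · simpa [he] using fun h' => absurd (h.2 h') he
  · intro S _
    have hs : (-1 : K) ^ #S = (-1) ^ (#(S ∪ A) + #A) * (-1) ^ #(S ∩ A) := by
      rw [← pow_add, add_right_comm, card_union_add_card_inter, add_assoc, pow_add, pow_add,
        ← mul_pow]
      simp
    have hz (a b c d e : ℤ) : q ^ (a + (b + c) - (d + c + e)) =
        q ^ (-c) * (q ^ (a - e) * q ^ (c + b - d)) := by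
      rw [← zpow_add₀ hq, ← zpow_add₀ hq]
      congr 1
      ring
    dsimp only
    rw [hs, hz]
    ring

/-- The generating series `∑_w χ_{(M | B)_w}(q) q^{-wt(w)} T^{|w|}` over all `w ∈ ℕ^B`. -/
def latticeSeries (M : Matroid E) (q : K) (B : Finset E) : K⟦X⟧ :=
  PowerSeries.mk fun n => ∑ w ∈ piAntidiag B n, M.latticeTerm q B w

/-- The monomial `q^{-rk A} T^{#A}`. -/
def rankMonomial (M : Matroid E) (q : K) (A : Finset E) : K⟦X⟧ :=
  PowerSeries.C (q ^ (-M.rkInt A)) * PowerSeries.X ^ #A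

theorem sum_latticeTerm_of_support_eq {M : Matroid E} (hM : M.E = Set.univ) {q : K} (hq : q ≠ 0)
    {A B : Finset E} (hAB : A ⊆ B) (n : ℕ) :
    ∑ w ∈ piAntidiag B n with univ.filter (w · ≠ 0) = A, M.latticeTerm q B w =
      PowerSeries.coeff n (PowerSeries.C (rankKernel q M.rkInt A B) *
        (M.rankMonomial q A * M.latticeSeries q A)) := by
  have hA : ∑ e ∈ A, (if e ∈ A then 1 else 0) = #A := by simp
  have hsupp {w : E → ℕ} (h : univ.filter (w · ≠ 0) = A) (e : E) : w e ≠ 0 ↔ e ∈ A := by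
    simp [← h]
  have hsum {w : E → ℕ} (h : univ.filter (w · ≠ 0) = A) : ∑ e ∈ B, w e = ∑ e ∈ A, w e :=
    (sum_subset hAB fun e _ he => not_not.1 fun h' => he ((hsupp h e).1 h')).symm
  rw [rankMonomial, mul_assoc, PowerSeries.coeff_C_mul, PowerSeries.coeff_C_mul,
    PowerSeries.coeff_X_pow_mul']
  split_ifs with hn
  · rw [latticeSeries, PowerSeries.coeff_mk, mul_sum, mul_sum]
    symm
    -- Subtracting `1_A` matches vectors of support exactly `A` and size `n` with all vectors in
    -- `ℕ^A` of size `n - #A`.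
    refine sum_nbij' (fun w e => w e + if e ∈ A then 1 else 0)
      (fun w e => w e - if e ∈ A then 1 else 0) ?_ ?_ ?_ ?_ ?_
    · intro w hw
      rw [mem_piAntidiag] at hw
      have h : univ.filter (fun e => (w e + if e ∈ A then 1 else 0) ≠ 0) = A := by
        ext e
        have := hw.2 e
        by_cases he : e ∈ A <;> simp_all
      rw [mem_filter, mem_piAntidiag]
      refine ⟨⟨?_, fun e he => hAB ((hsupp h e).1 he)⟩, h⟩
      have := hw.1
      rw [hsum h, sum_add_distrib, hA]
      lia
    · intro w hw
      rw [mem_filter, mem_piAntidiag] at hw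
      obtain ⟨⟨h1, h2⟩, h⟩ := hw
      rw [mem_piAntidiag]
      refine ⟨?_, fun e he => (hsupp h e).1 fun h0 => he (by simp [h0])⟩
      rw [hsum h] at h1
      rw [sum_tsub_distrib, h1, hA]
      intro e he
      rw [if_pos he]
      exact Nat.one_le_iff_ne_zero.2 ((hsupp h e).2 he)
    · intro w _
      simp
    · intro w hw
      rw [mem_filter] at hw
      funext e
      refine Nat.sub_add_cancel ?_
      split_ifs with he
      · exact Nat.one_le_iff_ne_zero.2 ((hsupp hw.2 e).2 he)
      · exact Nat.zero_le _
    · intro w hw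
      rw [mem_piAntidiag] at hw
      exact (latticeTerm_add_indicator hM hq hAB fun e he =>
        not_not.1 fun h' => he (hw.2 e h')).symm
  · rw [mul_zero, mul_zero]
    refine sum_eq_zero fun w hw => absurd ?_ hn
    rw [mem_filter, mem_piAntidiag] at hw
    rw [← hw.1.1, hsum hw.2, ← hA]
    refine sum_le_sum fun e he => ?_
    rw [if_pos he]
    exact Nat.one_le_iff_ne_zero.2 ((hsupp hw.2 e).2 he)

theorem latticeSeries_eq_sum {M : Matroid E} (hM : M.E = Set.univ) {q : K} (hq : q ≠ 0)
    (B : Finset E) : M.latticeSeries q B = ∑ A ∈ B.powerset,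
      PowerSeries.C (rankKernel q M.rkInt A B) * (M.rankMonomial q A * M.latticeSeries q A) := by
  ext n
  rw [map_sum, latticeSeries, PowerSeries.coeff_mk,
    ← sum_fiberwise_of_maps_to (g := fun w : E → ℕ => univ.filter (w · ≠ 0)) (t := B.powerset)]
  · exact sum_congr rfl fun A hA => sum_latticeTerm_of_support_eq hM hq (mem_powerset.1 hA) n
  · intro w hw
    rw [mem_piAntidiag] at hw
    exact mem_powerset.2 fun e he => hw.2 e (mem_filter.1 he).2

theorem sum_latticeTerm_of_exists_eq_zero {M : Matroid E} (hM : M.E = Set.univ) {q : K}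
    (hq : q ≠ 0) (n : ℕ) :
    ∑ w ∈ piAntidiag univ n with ∃ e, w e = 0, M.latticeTerm q univ w =
      PowerSeries.coeff n (∑ A ∈ (univ : Finset E).ssubsets,
        PowerSeries.C (rankKernel q M.rkInt A univ) *
          (M.rankMonomial q A * M.latticeSeries q A)) := by
  rw [map_sum, ← sum_fiberwise_of_maps_to (g := fun w : E → ℕ => univ.filter (w · ≠ 0))
    (t := (univ : Finset E).ssubsets)]
  · refine sum_congr rfl fun A hA => ?_
    rw [← sum_latticeTerm_of_support_eq hM hq (subset_univ A), filter_filter]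
    -- A vector has a zero coordinate exactly when its support is a proper subset.
    refine sum_congr (filter_congr fun w _ => and_iff_right_of_imp ?_) fun _ _ => rfl
    rintro rfl
    obtain ⟨e, -, he⟩ := exists_of_ssubset (mem_ssubsets.1 hA)
    exact ⟨e, by simpa using he⟩
  · intro w hw
    obtain ⟨e, he⟩ := (mem_filter.1 hw).2
    rw [mem_ssubsets, ssubset_univ_iff]
    intro h
    have := h ▸ mem_univ e
    simp [he] at this

/-- The initial value of the recursion. It is needed separately because the monomial of `∅` is `1`,
so the recursion does not determine the value there. -/
theorem rankMonomial_mul_latticeSeries_empty (M : Matroid E) (q : K) :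
    M.rankMonomial q ∅ * M.latticeSeries q ∅ = 1 := by
  have h0 : (fun _ : E => (0 : ℤ)) = 0 := rfl
  ext n
  by_cases hn : n = 0 <;>
    simp [rankMonomial, latticeSeries, latticeTerm, rkInt, piAntidiag_empty, h0, hn,
      PowerSeries.coeff_one]

end LatticeSeries

end Matroid

/-! ### Expansions of rational functions -/

namespace RationalFunctions

theorem laurentToQq_T (n : ℤ) : laurentToQq (LaurentPolynomial.T n) = RatFunc.X ^ n := by
  rw [laurentToQq, LaurentPolynomial.eval₂_T, Units.val_zpow_eq_zpow_val, Units.val_mk0]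

theorem laurentToQq_toLaurent (p : Polynomial ℤ) :
    laurentToQq (Polynomial.toLaurent p) = p.eval₂ (Int.castRingHom Qq) RatFunc.X := by
  rw [laurentToQq, LaurentPolynomial.eval₂_toLaurent, Units.val_mk0]

theorem expand_C (a : Qq) :
    expand (RatFunc.C a) = HahnSeries.ofPowerSeries ℤ Qq (PowerSeries.C a) := by
  rw [← RatFunc.algebraMap_C, ← Polynomial.coe_C]
  exact (RatFunc.coe_coe (Polynomial.C a)).symm

theorem expand_X_eq_ofPowerSeries :
    expand RatFunc.X = HahnSeries.ofPowerSeries ℤ Qq PowerSeries.X := by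
  rw [expand_X, HahnSeries.ofPowerSeries_X]

theorem C_mul_X_pow_ne_one {K : Type*} [Field K] (a : K) {n : ℕ} (hn : n ≠ 0) :
    RatFunc.C a * (RatFunc.X : RatFunc K) ^ n ≠ 1 := by
  rw [← RatFunc.algebraMap_X, ← RatFunc.algebraMap_C, ← map_pow, ← map_mul,
    ← map_one (algebraMap (Polynomial K) (RatFunc K))]
  intro h
  -- At `T = 0` the left side vanishes, since `n ≠ 0`.
  have := congrArg (Polynomial.eval 0) (RatFunc.algebraMap_injective K h)
  simp [hn] at this

theorem X_ne_one {K : Type*} [Field K] : (RatFunc.X : RatFunc K) ≠ 1 := by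
  simpa using C_mul_X_pow_ne_one (1 : K) one_ne_zero

end RationalFunctions

namespace Matroid

open Finset RationalFunctions

/-! ### Coefficients of the reduced zeta function as sums over lattice points -/

section Coefficients

variable {E : Type*} [Fintype E]

theorem minCoord_natCast_eq_zero {w : E → ℕ} (hw : ∃ e, w e = 0) :
    minCoord (fun e => (w e : ℤ)) = 0 := by
  obtain ⟨e, he⟩ := hw
  have : Nonempty E := ⟨e⟩
  apply le_antisymm
  · simpa [he] using minCoord_le (fun e => (w e : ℤ)) e
  · exact le_ciInf fun e => Int.natCast_nonneg _

theorem reducedCharPoly_eq_zero_of_isEmpty [IsEmpty E] (M : Matroid E) :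
    M.reducedCharPoly = 0 := by
  have (S : Set E) : M.rkNat S = 0 := by rw [Set.eq_empty_of_isEmpty S, rkNat_empty]
  simp [reducedCharPoly, rankNat, this]

/-- The factor `q - 1` restores the full characteristic polynomial, whose exponents
`rkNat_initialMatroid` turns into maximal weights. -/
theorem eval₂_reducedCharPoly_initialMatroid [Nonempty E] {M : Matroid E} (hM : M.E = Set.univ)
    (w : E → ℕ) : (M.initialMatroid (fun e => (w e : ℤ))).reducedCharPoly.eval₂
        (Int.castRingHom Qq) RatFunc.X * (RatFunc.X - 1) =
      RatFunc.X ^ M.wt (fun e => (w e : ℤ)) * M.latticeTerm (RatFunc.X : Qq) univ w := by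
  have h := congrArg (Polynomial.eval₂RingHom (Int.castRingHom Qq) RatFunc.X)
    (reducedCharPoly_mul (M.initialMatroid (fun e => (w e : ℤ))))
  simp only [map_mul, map_sub, map_one, Polynomial.coe_eval₂RingHom, Polynomial.eval₂_X] at h
  rw [h, charPoly, latticeTerm, Polynomial.eval₂_finsetSum, powerset_univ, mul_sum]
  refine sum_congr rfl fun S _ => ?_
  have hle : (M.initialMatroid (fun e => (w e : ℤ))).rkNat S ≤
      (M.initialMatroid (fun e => (w e : ℤ))).rankNat :=
    rkNat_mono _ (by rw [initialMatroid_ground, hM]; exact Set.subset_univ _)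
  have hrk : M.rkInt univ = M.rankNat := by rw [rkInt, coe_univ, rankNat, hM]
  rw [Polynomial.eval₂_mul, Polynomial.eval₂_pow, Polynomial.eval₂_pow, Polynomial.eval₂_neg,
    Polynomial.eval₂_one, Polynomial.eval₂_X, mul_left_comm, ← zpow_natCast RatFunc.X,
    ← zpow_add₀ RatFunc.X_ne_zero, Nat.cast_sub hle,
    rkNat_initialMatroid _ (hM ▸ Set.subset_univ _), rankNat_initialMatroid, hrk]
  congr 2
  ring

theorem laurentToQq_reducedZeta_term [Nonempty E] {M : Matroid E} (hM : M.E = Set.univ)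
    {w : E → ℕ} (hw : ∃ e, w e = 0) :
    laurentToQq (Polynomial.toLaurent (M.initialMatroidBar (QuotientAddGroup.mk
        (fun e => (w e : ℤ)))).reducedCharPoly * LaurentPolynomial.T (-((M.rankNat : ℤ) - 1) -
          M.wtBar (QuotientAddGroup.mk (fun e => (w e : ℤ))))) =
      RatFunc.X ^ (-((M.rankNat : ℤ) - 1)) / (RatFunc.X - 1) *
        M.latticeTerm (RatFunc.X : Qq) univ w := by
  have h1 : (RatFunc.X - 1 : Qq) ≠ 0 := sub_ne_zero.2 X_ne_one
  have hX : (RatFunc.X : Qq) ≠ 0 := RatFunc.X_ne_zero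
  rw [map_mul, laurentToQq_T, laurentToQq_toLaurent, initialMatroidBar, ModOnes.lift_mk, wtBar,
    ModOnes.lift_mk, minCoord_natCast_eq_zero hw, mul_zero, sub_zero, div_mul_eq_mul_div,
    eq_div_iff h1, mul_right_comm, eval₂_reducedCharPoly_initialMatroid hM, zpow_sub₀ hX]
  field_simp

variable [DecidableEq E]

/-- The classes in `ℤ^E / ℤ𝟏` correspond to the `w ∈ ℕ^E` with a vanishing coordinate. -/
theorem sum_totalWeightBar_eq [Nonempty E] {R : Type*} [AddCommMonoid R] (F : ModOnes E → R)
    (n : ℕ) : ∑ v ∈ (finite_totalWeightBar_eq (E := E) n).toFinset, F v =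
      ∑ w ∈ piAntidiag (univ : Finset E) n with ∃ e, w e = 0,
        F (QuotientAddGroup.mk (fun e => (w e : ℤ))) := by
  symm
  refine sum_bij (fun w _ => QuotientAddGroup.mk (fun e => (w e : ℤ))) ?_ ?_ ?_
    (fun _ _ => rfl)
  · intro w hw
    rw [mem_filter, mem_piAntidiag] at hw
    rw [Set.Finite.mem_toFinset, Set.mem_ofPred_eq, totalWeightBar_mk,
      minCoord_natCast_eq_zero hw.2, ← hw.1.1]
    simp
  · intro w hw w' hw' h
    obtain ⟨c, hc⟩ := QuotientAddGroup.leftRel_apply.1 (Quotient.exact' h)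
    have hc' (e : E) : (w' e : ℤ) = w e + c := by
      have := congrFun hc e
      simp at this
      linarith
    -- Both representatives have minimum `0`, so the constant `c` by which they differ is `0`.
    have h0 := minCoord_add_const (fun e => (w e : ℤ)) c
    simp only [← hc', minCoord_natCast_eq_zero (mem_filter.1 hw).2,
      minCoord_natCast_eq_zero (mem_filter.1 hw').2] at h0
    funext e
    have := hc' e
    lia
  · intro v hv
    rw [Set.Finite.mem_toFinset, Set.mem_ofPred_eq] at hv
    induction v using QuotientAddGroup.induction_on with
    | H w =>
      rw [totalWeightBar_mk] at hv
      have h0 (e : E) : ((w e - minCoord w).toNat : ℤ) = w e - minCoord w :=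
        Int.toNat_of_nonneg (sub_nonneg.2 (minCoord_le w e))
      -- The representative is the lift whose least coordinate is `0`.
      refine ⟨fun e => (w e - minCoord w).toNat, ?_, ?_⟩
      · rw [mem_filter, mem_piAntidiag]
        refine ⟨⟨?_, fun e _ => mem_univ e⟩, ?_⟩
        · rw [← Nat.cast_inj (R := ℤ), Nat.cast_sum, ← hv]
          exact sum_congr rfl fun e _ => h0 e
        · obtain ⟨e, he⟩ := exists_eq_ciInf_of_finite (f := w)
          exact ⟨e, by rw [minCoord, ← he]; simp⟩
      · rw [QuotientAddGroup.eq]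
        refine ⟨minCoord w, ?_⟩
        funext e
        simp [h0]

theorem map_laurentToQq_reducedZeta [Nonempty E] {M : Matroid E} (hM : M.E = Set.univ) :
    PowerSeries.map laurentToQq M.reducedZeta =
      PowerSeries.C (RatFunc.X ^ (-((M.rankNat : ℤ) - 1)) / (RatFunc.X - 1)) *
        ∑ A ∈ (univ : Finset E).ssubsets, PowerSeries.C (rankKernel RatFunc.X M.rkInt A univ) *
          (M.rankMonomial RatFunc.X A * M.latticeSeries RatFunc.X A) := by
  ext n
  rw [PowerSeries.coeff_C_mul, ← sum_latticeTerm_of_exists_eq_zero hM RatFunc.X_ne_zero,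
    PowerSeries.coeff_map, reducedZeta, PowerSeries.coeff_mk, sum_totalWeightBar_eq, map_sum,
    mul_sum]
  exact sum_congr rfl fun w hw => laurentToQq_reducedZeta_term hM (mem_filter.1 hw).2

end Coefficients

/-! ### The rational function and its functional equation -/

section Rational

variable {E : Type*}

/-- The rational function `q^{-rk A} T^{#A}`. -/
def rankMonomialRat (M : Matroid E) (A : Finset E) : QqT :=
  RatFunc.C ((RatFunc.X : Qq) ^ (-M.rkInt A)) * RatFunc.X ^ #A

theorem expand_rankMonomialRat (M : Matroid E) (A : Finset E) : expand (M.rankMonomialRat A) =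
    HahnSeries.ofPowerSeries ℤ Qq (M.rankMonomial RatFunc.X A) := by
  rw [rankMonomialRat, rankMonomial, map_mul, map_mul, map_pow, map_pow, expand_C,
    expand_X_eq_ofPowerSeries]

theorem rankMonomialRat_ne_one (M : Matroid E) {A : Finset E} (hA : A ≠ ∅) :
    M.rankMonomialRat A ≠ 1 :=
  C_mul_X_pow_ne_one _ (card_ne_zero.2 (nonempty_iff_ne_empty.2 hA))

theorem invertQT_rankMonomialRat (M : Matroid E) (A : Finset E) :
    invertQT (M.rankMonomialRat A) = (M.rankMonomialRat A)⁻¹ := by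
  rw [rankMonomialRat, invertQT, map_mul, map_pow, invMap_X, invMap_C, map_zpow₀, invertQ,
    invMap_X, inv_zpow, map_inv₀, mul_inv, inv_pow]

variable [DecidableEq E]

theorem expand_rankKernel (M : Matroid E) (A B : Finset E) :
    expand (rankKernel (RatFunc.C (RatFunc.X : Qq)) M.rkInt A B) =
      HahnSeries.ofPowerSeries ℤ Qq (PowerSeries.C (rankKernel RatFunc.X M.rkInt A B)) := by
  rw [← map_rankKernel, expand_C]

variable [Fintype E]

/-- The reduced motivic zeta function of `M` as a rational function, for a nonempty ground set. -/
def reducedZetaRat (M : Matroid E) : QqT :=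
  RatFunc.C ((RatFunc.X : Qq) ^ (-((M.rankNat : ℤ) - 1)) / (RatFunc.X - 1)) *
    ∑ A ∈ (univ : Finset E).ssubsets, rankKernel (RatFunc.C (RatFunc.X : Qq)) M.rkInt A univ *
      chainSum (RatFunc.C (RatFunc.X : Qq)) M.rkInt M.rankMonomialRat A

/-- The series satisfy the recursion defining the chain sums, and that recursion has only one
solution in the field of Laurent series. -/
theorem expand_chainSum {M : Matroid E} (hM : M.E = Set.univ) (B : Finset E) :
    expand (chainSum (RatFunc.C (RatFunc.X : Qq)) M.rkInt M.rankMonomialRat B) =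
      HahnSeries.ofPowerSeries ℤ Qq
        (M.rankMonomial RatFunc.X B * M.latticeSeries RatFunc.X B) := by
  refine map_chainSum_eq (fun B hB => M.rankMonomialRat_ne_one hB) expand
    (f := fun B => HahnSeries.ofPowerSeries ℤ Qq
      (M.rankMonomial RatFunc.X B * M.latticeSeries RatFunc.X B)) ?_ ?_ B
  · rw [rankMonomial_mul_latticeSeries_empty, map_one]
  · intro B _
    simp only [expand_rankMonomialRat, expand_rankKernel]
    rw [map_mul]
    congr 1
    rw [latticeSeries_eq_sum hM RatFunc.X_ne_zero, map_sum]
    exact sum_congr rfl fun A _ => map_mul _ _ _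

theorem expand_reducedZetaRat [Nonempty E] {M : Matroid E} (hM : M.E = Set.univ) :
    expand M.reducedZetaRat = toLaurentSeries M.reducedZeta := by
  rw [toLaurentSeries, map_laurentToQq_reducedZeta hM, reducedZetaRat, map_mul, map_mul,
    expand_C, map_sum, map_sum]
  congr 1
  refine sum_congr rfl fun A _ => ?_
  rw [map_mul, map_mul, expand_chainSum hM, expand_rankKernel]

theorem invertQT_reducedZetaRat {M : Matroid E} (hM : M.E = Set.univ) :
    invertQT M.reducedZetaRat =
      RatFunc.C ((RatFunc.X : Qq) ^ ((M.rankNat : ℤ) - 1)) * M.reducedZetaRat := by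
  have hX : (RatFunc.X : Qq) ≠ 0 := RatFunc.X_ne_zero
  have hC : (RatFunc.C RatFunc.X : QqT) ≠ 0 := (map_ne_zero _).2 hX
  have hrk : M.rkInt univ = M.rankNat := by rw [rkInt, coe_univ, rankNat, hM]
  have h1 : (RatFunc.X - 1 : Qq) ≠ 0 := sub_ne_zero.2 X_ne_one
  have hinv : invertQ RatFunc.X = (RatFunc.X : Qq)⁻¹ := invMap_X _
  -- The inverted prefactor times the reciprocity factor `-q^{-rk M}` is `1 / (q - 1)`, and so is
  -- `q^{rk M - 1}` times the original prefactor.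
  have hcoeff : invertQ (RatFunc.X ^ (-((M.rankNat : ℤ) - 1)) / (RatFunc.X - 1)) *
      -RatFunc.X ^ (-(M.rankNat : ℤ)) = RatFunc.X ^ ((M.rankNat : ℤ) - 1) *
        (RatFunc.X ^ (-((M.rankNat : ℤ) - 1)) / (RatFunc.X - 1)) := by
    have h3 : (RatFunc.X : Qq)⁻¹ - 1 = -(RatFunc.X - 1) / RatFunc.X := by
      field_simp
      ring
    rw [map_div₀, map_zpow₀, map_sub, map_one, hinv, h3, inv_zpow', neg_neg, zpow_neg, zpow_neg,
      zpow_sub_one₀ hX]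
    have := zpow_ne_zero (M.rankNat : ℤ) hX
    field_simp
  rw [reducedZetaRat, map_mul, map_sum_ssubsets_chainSum_eq (x := M.rankMonomialRat) hC (by simp [rkInt])
    (fun B => mul_ne_zero ((map_ne_zero _).2 (zpow_ne_zero _ hX))
      (pow_ne_zero _ RatFunc.X_ne_zero))
    (fun B hB => M.rankMonomialRat_ne_one hB)
    (by rw [invertQT, invMap_C, hinv, map_inv₀]) M.invertQT_rankMonomialRat, hrk, ← mul_assoc,
    ← mul_assoc, ← map_mul RatFunc.C, ← hcoeff, invertQT, invMap_C, map_mul, map_neg, map_zpow₀]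

end Rational

end Matroid

end

theorem mainTheorem1 {E : Type*} [Fintype E] (M : Matroid E) (hM : M.E = Set.univ) :
    ∃ R : RationalFunctions.QqT,
      RationalFunctions.expand R = RationalFunctions.toLaurentSeries M.reducedZeta ∧
      RationalFunctions.invertQT R =
        RatFunc.C ((RatFunc.X : RationalFunctions.Qq) ^ ((M.rankNat : ℤ) - 1)) * R := by
  classical
  rcases isEmpty_or_nonempty E with h | h
  -- On the empty ground set the reduced characteristic polynomial is `0`, so both sides vanish.
  · have h0 : M.reducedZeta = 0 := by
      ext1 n
      simp [Matroid.reducedZeta, Matroid.reducedCharPoly_eq_zero_of_isEmpty]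
    exact ⟨0, by simp [h0, RationalFunctions.toLaurentSeries], by simp⟩
  · exact ⟨M.reducedZetaRat, Matroid.expand_reducedZetaRat hM, Matroid.invertQT_reducedZetaRat hM⟩
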